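/- Let $X$ be a real normed space (for instance a Banach space), $T:X\to X$ nonexpansive (i.e. $\|Tx-Ty\|\le\|x-y\|$), $f:[0,\infty)\to X$ continuous, $x_0\in X$, and let $u:[0,\infty)\to X$ be a solution of $$u'(t)+(I-T)u(t)=f(t)\quad(t\ge 0),\qquad u(0)=x_0 .$$ Let $\epsilon:[0,\infty)\to[0,\infty)$ be continuous with $\epsilon(t)\ge\|f(t)\|$ for all $t\geq 0$. Consider the conditions * $(H_2')$: $T$ has bounded range; * $(H_2'')$: $\mathrm{Fix}(T)\ne\emptyset$, $\epsilon$ is nonincreasing and $S:=\int_0^\infty\epsilon(t)\,dt<\infty$. **(1)** Assume $(H_2'')$, and put $\kappa=2\,\mathrm{dist}(x_0,\mathrm{Fix}(T))+S$ and $\nu=(\kappa+2\sqrt2\,S)/\sqrt\pi$. Then for all $t\ge1$ $$\|u'(t)\|\le\frac{\nu}{\sqrt t}+\int_{t/2}^\infty 4\,\epsilon(s)\,ds .$$ Moreover, if $\varphi:[0,\infty)\to[0,\infty)$ is nondecreasing with $\mu=\int_0^\infty\varphi(s)\epsilon(s)\,ds<\infty$, then for all $t\ge1$ with $\varphi(t/2)>0$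 $$\|u'(t)\|\le\frac{\nu}{\sqrt t}+\frac{4\mu}{\varphi(t/2)} .$$ In particular, if $\int_0^\infty s^a\epsilon(s)\,ds<\infty$ for some $a\ge0$, then $\|u'(t)\|=O(1/t^{b})$ as $t\to\infty$, with $b=\min\{\tfrac12,a\}$. **(2)** Assume $(H_2')$ or $(H_2'')$, and $\epsilon(t)=O(1/t^a)$ as $t\to\infty$ with $a\ge\frac12$. Then, as $t\to\infty$: * if $\frac12\le a<1$, then $\|u'(t)\|=O(1/t^{a-1/2})$; * if $a=1$, then $\|u'(t)\|=O(\log t/\sqrt t)$; * if $a>1$, then $\|u'(t)\|=O(1/\sqrt t)$. -/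

import Mathlib

open Set Filter MeasureTheory Asymptotics

/-- `u : [0,∞) → X` solves `u'(t) + (I - T) u(t) = f(t)` for all `t ≥ 0`, with `u(0) = x₀`
(at `t = 0` the derivative is the right derivative).  Values of `u` and `f` at negative times are
irrelevant. -/
structure IsEvolutionSolution {X : Type*} [NormedAddCommGroup X] [NormedSpace ℝ X]
    (T : X → X) (f : ℝ → X) (x₀ : X) (u : ℝ → X) : Prop where
  initial : u 0 = x₀
  equation : ∀ t : ℝ, 0 ≤ t → ∃ v : X, HasDerivWithinAt u v (Ici 0) t ∧ v + (u t - T (u t)) = f t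

/-- `ε : [0,∞) → ℝ` is a continuous function that dominates the norm of `f`. -/
structure IsErrorBound {X : Type*} [NormedAddCommGroup X] (f : ℝ → X) (ε : ℝ → ℝ) : Prop where
  continuousOn : ContinuousOn ε (Ici 0)
  norm_le : ∀ t : ℝ, 0 ≤ t → ‖f t‖ ≤ ε t

/-- First alternative: the map `T` has a bounded range. -/
def HypBoundedRange {X : Type*} [NormedAddCommGroup X] (T : X → X) : Prop :=
  Bornology.IsBounded (range T)

/-- Second alternative: `T` has a fixed point, and `ε` is nonincreasing on `[0,∞)` with
`∫₀^∞ ε < ∞`. -/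
structure HypFixedPoint {X : Type*} [NormedAddCommGroup X] (T : X → X) (ε : ℝ → ℝ) : Prop where
  nonempty_fix : (Function.fixedPoints T).Nonempty
  antitoneOn : AntitoneOn ε (Ici 0)
  integrableOn : IntegrableOn ε (Ioi 0)

/-- `S = ∫₀^∞ ε(t) dt`. -/
noncomputable def totalError (ε : ℝ → ℝ) : ℝ := ∫ t in Ioi (0 : ℝ), ε t

/-- `κ = 2 dist(x₀, Fix T) + S`. -/
noncomputable def kappaConst {X : Type*} [NormedAddCommGroup X] (T : X → X) (x₀ : X)
    (ε : ℝ → ℝ) : ℝ :=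
  2 * Metric.infDist x₀ (Function.fixedPoints T) + totalError ε

/-- `ν = (κ + 2 √2 S) / √π`. -/
noncomputable def nuConst {X : Type*} [NormedAddCommGroup X] (T : X → X) (x₀ : X)
    (ε : ℝ → ℝ) : ℝ :=
  (kappaConst T x₀ ε + 2 * √2 * totalError ε) / √Real.pi

/-! Since `u' = f + (T u - u)`, it suffices to bound `‖T (u t) - u t‖`. The idea is to bound
two-parameter quantities at once: `D(s,t) = ‖u t - u s‖` and `R(s,t) = ‖T (u t) - u s‖` for `s ≤ t`.
Multiplying the equation by the exponential and using nonexpansiveness gives, in integrated form,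
`∂ₜD ≤ R + e(t) - D` and `∂ₛR ≤ D + e(s) - R`, with `D(s,s) = 0` and `R(0,t) ≤ κ`, where `κ` bounds
`‖T (u t) - x₀‖`.

The linear system with equalities has an explicit solution as an integral over an angle, up to a
harmless larger boundary value of `R`: these are `distMajorant` and `residualMajorant`. Their
differential equations rest on `integral_angularKernel`. The comparison `norm_residual_le` holds
because one pass through the two inequalities multiplies any additive error by a factor less than
`1` on a bounded time interval, so that iteration removes it.

On the diagonal the majorant becomes `κ h(t) + 2 ∫₀ᵗ h(t-q) e(q) dq` with `h = decayProfile`, and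
`h(y) ≤ min(1, 1/√(πy))` for `y > 0`. Splitting the convolution at `t/2` (`norm_deriv_le_split`)
yields every stated rate: the old half contributes `∫ε / √t`, while the recent half is controlled by
`h ≤ 1` or by `∫₀ˣ h ≤ 2√x`. -/

/-! ### The angular kernel and its constant integral. -/

theorem hasDerivAt_intervalIntegral_of_continuous {F F' : ℝ → ℝ → ℝ} {a b : ℝ}
    (hF : Continuous (Function.uncurry F)) (hF' : Continuous (Function.uncurry F'))
    (h : ∀ x θ, HasDerivAt (fun x => F x θ) (F' x θ) x) (x : ℝ) :
    HasDerivAt (fun x => ∫ θ in a..b, F x θ) (∫ θ in a..b, F' x θ) x := by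
  obtain ⟨C, hC⟩ := ((isCompact_closedBall x 1).prod
    (isCompact_uIcc (a := a) (b := b))).exists_bound_of_continuousOn hF'.continuousOn
  refine (intervalIntegral.hasDerivAt_integral_of_dominated_loc_of_deriv_le
    (bound := fun _ => C) (Metric.closedBall_mem_nhds x one_pos)
    (Eventually.of_forall fun y => ?_) ?_ ?_ ?_ (by simp) ?_).2
  · exact (hF.comp (Continuous.prodMk_right y)).aestronglyMeasurable
  · exact (hF.comp (Continuous.prodMk_right x)).intervalIntegrable _ _
  · exact (hF'.comp (Continuous.prodMk_right x)).aestronglyMeasurable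
  · exact Eventually.of_forall fun θ hθ y hy => hC (y, θ) ⟨hy, uIoc_subset_uIcc hθ⟩
  · exact Eventually.of_forall fun θ _ y _ => h y θ

/-- The function `sin (x * σ) / σ`, extended by continuity to `σ = 0`. -/
noncomputable def sincMul (x σ : ℝ) : ℝ := x * Real.sinc (x * σ)

theorem mul_sincMul (x σ : ℝ) : σ * sincMul x σ = Real.sin (x * σ) := by
  unfold sincMul
  rcases eq_or_ne (x * σ) 0 with h | h
  · rw [h]; simpa [or_comm] using h
  · rw [Real.sinc_of_ne_zero h]
    field_simp [left_ne_zero_of_mul h, right_ne_zero_of_mul h]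

@[simp] theorem sincMul_zero_left (σ : ℝ) : sincMul 0 σ = 0 := by simp [sincMul]

@[fun_prop] theorem Continuous.sincMul {α : Type*} [TopologicalSpace α] {f g : α → ℝ}
    (hf : Continuous f) (hg : Continuous g) : Continuous fun a => sincMul (f a) (g a) :=
  hf.mul (Real.continuous_sinc.comp (hf.mul hg))

theorem hasDerivAt_sincMul (σ x : ℝ) :
    HasDerivAt (fun x => sincMul x σ) (Real.cos (x * σ)) x := by
  rcases eq_or_ne σ 0 with rfl | h
  · simpa [sincMul] using hasDerivAt_id' x
  · have : (fun x => sincMul x σ) = fun x => Real.sin (x * σ) / σ := by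
      ext y; rw [← mul_sincMul]; field_simp
    rw [this]
    have := (((hasDerivAt_id x).mul_const σ).sin).div_const σ
    refine this.congr_deriv ?_
    simp; field_simp

/-- The kernel whose integral over `[0, π]` is constant in `y`. -/
noncomputable def angularKernel (x θ : ℝ) : ℝ :=
  Real.cos (x * Real.sin θ) + Real.cos θ * sincMul x (Real.sin θ)

@[fun_prop] theorem Continuous.angularKernel {α : Type*} [TopologicalSpace α] {f g : α → ℝ}
    (hf : Continuous f) (hg : Continuous g) : Continuous fun a => angularKernel (f a) (g a) := by
  unfold _root_.angularKernel; fun_prop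

/-- Together with `hasDerivAt_sincMul`, this makes the pair (`sincMul`, `angularKernel`) a linear
system in `x` for each fixed angle. The factor `exp (-(s + t) * (1 - cos θ))` then turns it into the
coupled system required of the two majorants. -/
theorem hasDerivAt_angularKernel (θ x : ℝ) : HasDerivAt (fun x => angularKernel x θ)
    (Real.cos θ * angularKernel x θ - sincMul x (Real.sin θ)) x := by
  have h := (((hasDerivAt_id x).mul_const (Real.sin θ)).cos).add
    ((hasDerivAt_sincMul (Real.sin θ) x).const_mul (Real.cos θ))
  refine h.congr_deriv ?_
  simp only [id, one_mul, angularKernel]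
  linear_combination Real.sin θ * mul_sincMul x (Real.sin θ) - (sincMul x (Real.sin θ)) * Real.sin_sq_add_cos_sq θ

/-- The integrand has an explicit antiderivative that vanishes at both endpoints; its formula
divides by `y`, hence the separate case `y = 0`. -/
theorem integral_exp_mul_cos_eq_zero (y : ℝ) :
    ∫ θ in (0 : ℝ)..Real.pi, Real.exp (y * Real.cos θ) *
      (Real.cos (2 * θ + y * Real.sin θ) + Real.cos (θ + y * Real.sin θ)) = 0 := by
  have hc : Continuous fun θ => Real.exp (y * Real.cos θ) *
      (Real.cos (2 * θ + y * Real.sin θ) + Real.cos (θ + y * Real.sin θ)) := by fun_prop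
  rcases eq_or_ne y 0 with rfl | hy
  · have h : ∀ θ : ℝ, HasDerivAt (fun θ => Real.sin (2 * θ) / 2 + Real.sin θ)
        (Real.exp (0 * Real.cos θ) *
      (Real.cos (2 * θ + 0 * Real.sin θ) + Real.cos (θ + 0 * Real.sin θ))) θ := by
      intro θ
      refine ((((((hasDerivAt_id θ).const_mul 2).sin).div_const 2).add
        (Real.hasDerivAt_sin θ))).congr_deriv ?_
      simp
    rw [intervalIntegral.integral_eq_sub_of_hasDerivAt (fun θ _ => h θ)
      (hc.intervalIntegrable _ _)]
    simp
  · have h : ∀ θ : ℝ, HasDerivAt (fun θ => Real.exp (y * Real.cos θ) *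
          (Real.sin (θ + y * Real.sin θ) + (1 - 1 / y) * Real.sin (y * Real.sin θ)) / y)
        (Real.exp (y * Real.cos θ) *
      (Real.cos (2 * θ + y * Real.sin θ) + Real.cos (θ + y * Real.sin θ))) θ := by
      intro θ
      have h1 := ((Real.hasDerivAt_cos θ).const_mul y).exp
      have h2 := (Real.hasDerivAt_sin θ).const_mul y
      refine ((h1.mul ((((hasDerivAt_id θ).add h2).sin).add
        (h2.sin.const_mul (1 - 1 / y)))).div_const y).congr_deriv ?_
      have e1 : Real.cos (2 * θ + y * Real.sin θ) = Real.cos θ * Real.cos (θ + y * Real.sin θ)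
          - Real.sin θ * Real.sin (θ + y * Real.sin θ) := by
        rw [← Real.cos_add]; ring_nf
      rw [e1, Real.cos_add, Real.sin_add]
      simp only [id, Pi.add_apply, Real.cos_add, Real.sin_add]
      field_simp
      ring_nf
    rw [intervalIntegral.integral_eq_sub_of_hasDerivAt (fun θ _ => h θ)
      (hc.intervalIntegrable _ _)]
    simp

/-- The derivative in `y` is `exp (-y)` times the vanishing integral above, so the value is that at
`y = 0`, namely `∫ (1 + cos θ) = π`. This normalises the source term and the boundary value of
`residualMajorant`. -/
theorem integral_angularKernel (y : ℝ) :
    ∫ θ in (0 : ℝ)..Real.pi, Real.exp (-y * (1 - Real.cos θ)) * (1 + Real.cos θ) *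
      angularKernel y θ = Real.pi := by
  have hd : ∀ x, HasDerivAt (fun x => ∫ θ in (0 : ℝ)..Real.pi,
      Real.exp (-x * (1 - Real.cos θ)) * (1 + Real.cos θ) * angularKernel x θ) 0 x := by
    intro x
    refine (hasDerivAt_intervalIntegral_of_continuous (F := fun x θ =>
      Real.exp (-x * (1 - Real.cos θ)) * (1 + Real.cos θ) * angularKernel x θ)
      (F' := fun x θ => Real.exp (-x) * (Real.exp (x * Real.cos θ) *
      (Real.cos (2 * θ + x * Real.sin θ) + Real.cos (θ + x * Real.sin θ))))
      (by simp only [Function.uncurry_def]; fun_prop)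
      (by simp only [Function.uncurry_def]; fun_prop)
      (fun x θ => ?_) x).congr_deriv ?_
    · refine (((((hasDerivAt_id x).neg.mul_const (1 - Real.cos θ)).exp).mul_const
        (1 + Real.cos θ)).mul (hasDerivAt_angularKernel θ x)).congr_deriv ?_
      simp only [id, Pi.neg_apply]
      rw [show -x * (1 - Real.cos θ) = -x + x * Real.cos θ by ring, Real.exp_add, Real.cos_add,
        Real.cos_add, Real.cos_two_mul, Real.sin_two_mul, ← mul_sincMul, angularKernel]
      generalize sincMul x (Real.sin θ) = A
      linear_combination (Real.exp (-x) * Real.exp (x * Real.cos θ) *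
        (2 * Real.cos θ + 1) * A) * Real.sin_sq_add_cos_sq θ
    · rw [intervalIntegral.integral_const_mul, integral_exp_mul_cos_eq_zero, mul_zero]
  have := is_const_of_deriv_eq_zero (fun x => (hd x).differentiableAt) (fun x => (hd x).deriv) y 0
  rw [this]
  simp [angularKernel, intervalIntegral.integral_add]

/-! ### Explicit solution of the coupled linear system. -/

section Majorant

variable (e : ℝ → ℝ) (κ : ℝ)

/-- The accumulated weight at frequency `θ`. -/
noncomputable def angularWeight (s θ : ℝ) : ℝ :=
  κ + 2 * ∫ q in (0 : ℝ)..s, Real.exp (2 * q * (1 - Real.cos θ)) * e q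

/-- The majorant of `‖u t - u s‖`. -/
noncomputable def distMajorant (s t : ℝ) : ℝ :=
  (∫ q in s..t, e q) + Real.pi⁻¹ * ∫ θ in (0 : ℝ)..Real.pi,
    Real.exp (-(s + t) * (1 - Real.cos θ)) * (1 + Real.cos θ) *
      sincMul (t - s) (Real.sin θ) * angularWeight e κ s θ

/-- The majorant of `‖T (u t) - u s‖`. -/
noncomputable def residualMajorant (s t : ℝ) : ℝ :=
  (∫ q in s..t, e q) + Real.pi⁻¹ * ∫ θ in (0 : ℝ)..Real.pi,
    Real.exp (-(s + t) * (1 - Real.cos θ)) * (1 + Real.cos θ) *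
      angularKernel (t - s) θ * angularWeight e κ s θ

variable {e}

theorem Continuous.angularWeight (he : Continuous e) {α : Type*} [TopologicalSpace α]
    {f g : α → ℝ} (hf : Continuous f) (hg : Continuous g) :
    Continuous fun a => angularWeight e κ (f a) (g a) := by
  unfold _root_.angularWeight
  refine continuous_const.add (continuous_const.mul ?_)
  exact intervalIntegral.continuous_parametric_intervalIntegral_of_continuous
    (f := fun a q => Real.exp (2 * q * (1 - Real.cos (g a))) * e q)
    (by simp only [Function.uncurry_def]; fun_prop) hf

theorem hasDerivAt_angularWeight (he : Continuous e) (s θ : ℝ) :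
    HasDerivAt (fun s => angularWeight e κ s θ)
      (2 * (Real.exp (2 * s * (1 - Real.cos θ)) * e s)) s := by
  refine (((Continuous.integral_hasStrictDerivAt ?_ 0 s).hasDerivAt).const_mul 2).const_add κ
  fun_prop

theorem distMajorant_self (s : ℝ) : distMajorant e κ s s = 0 := by
  simp [distMajorant]

theorem continuous_distMajorant (he : Continuous e) :
    Continuous fun p : ℝ × ℝ => distMajorant e κ p.1 p.2 := by
  unfold distMajorant
  refine Continuous.add ?_ (continuous_const.mul ?_)
  · have : (fun p : ℝ × ℝ => ∫ q in p.1..p.2, e q) =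
        fun p => (∫ q in (0 : ℝ)..p.2, e q) - ∫ q in (0 : ℝ)..p.1, e q := by
      ext p
      rw [intervalIntegral.integral_interval_sub_left] <;> exact he.intervalIntegrable _ _
    rw [this]
    have h := intervalIntegral.continuous_primitive (μ := volume)
      (fun a b => he.intervalIntegrable a b) 0
    exact (h.comp continuous_snd).sub (h.comp continuous_fst)
  · refine intervalIntegral.continuous_parametric_intervalIntegral_of_continuous'
      (f := fun (p : ℝ × ℝ) θ => Real.exp (-(p.1 + p.2) * (1 - Real.cos θ)) * (1 + Real.cos θ) *
      sincMul (p.2 - p.1) (Real.sin θ) * angularWeight e κ p.1 θ) ?_ _ _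
    simp only [Function.uncurry_def]
    refine Continuous.mul (by fun_prop) (he.angularWeight κ (by fun_prop) (by fun_prop))

theorem hasDerivAt_distMajorant (he : Continuous e) (s t : ℝ) :
    HasDerivAt (fun t => distMajorant e κ s t)
      (residualMajorant e κ s t + e t - distMajorant e κ s t) t := by
  have hE : HasDerivAt (fun t => ∫ q in s..t, e q) (e t) t :=
    (he.integral_hasStrictDerivAt s t).hasDerivAt
  have hP : Continuous fun p : ℝ × ℝ => angularWeight e κ s p.2 :=
    he.angularWeight κ continuous_const continuous_snd
  have hW : Continuous fun θ : ℝ => angularWeight e κ s θ :=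
    he.angularWeight κ continuous_const continuous_id
  have hI := hasDerivAt_intervalIntegral_of_continuous (a := 0) (b := Real.pi)
    (F := fun t θ => Real.exp (-(s + t) * (1 - Real.cos θ)) * (1 + Real.cos θ) *
      sincMul (t - s) (Real.sin θ) * angularWeight e κ s θ)
    (F' := fun t θ => Real.exp (-(s + t) * (1 - Real.cos θ)) * (1 + Real.cos θ) *
      angularKernel (t - s) θ * angularWeight e κ s θ
      - Real.exp (-(s + t) * (1 - Real.cos θ)) * (1 + Real.cos θ) *
      sincMul (t - s) (Real.sin θ) * angularWeight e κ s θ)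
    (by simp only [Function.uncurry_def]; fun_prop)
    (by simp only [Function.uncurry_def]; fun_prop)
    (fun t θ => by
      have h1 := (((((hasDerivAt_id t).const_add s).neg).mul_const (1 - Real.cos θ)).exp)
      have h2 := (hasDerivAt_sincMul (Real.sin θ) (t - s)).comp t ((hasDerivAt_id t).sub_const s)
      refine (((h1.mul_const (1 + Real.cos θ)).mul h2).mul_const _).congr_deriv ?_
      simp only [id, Pi.neg_apply, angularKernel, Function.comp]
      ring) t
  refine (hE.add (hI.const_mul Real.pi⁻¹)).congr_deriv ?_
  rw [intervalIntegral.integral_sub, residualMajorant, distMajorant]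
  · ring
  all_goals exact Continuous.intervalIntegrable (by fun_prop) _ _

theorem hasDerivAt_residualMajorant (he : Continuous e) (s t : ℝ) :
    HasDerivAt (fun s => residualMajorant e κ s t)
      (distMajorant e κ s t + e s - residualMajorant e κ s t) s := by
  have hE : HasDerivAt (fun s => ∫ q in s..t, e q) (-e s) s :=
    intervalIntegral.integral_hasDerivAt_left (he.intervalIntegrable _ _)
      he.stronglyMeasurable.stronglyMeasurableAtFilter he.continuousAt
  have hP : Continuous fun p : ℝ × ℝ => angularWeight e κ p.1 p.2 :=
    he.angularWeight κ continuous_fst continuous_snd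
  have hW : Continuous fun θ : ℝ => angularWeight e κ s θ :=
    he.angularWeight κ continuous_const continuous_id
  have hI := hasDerivAt_intervalIntegral_of_continuous (a := 0) (b := Real.pi)
    (F := fun s θ => Real.exp (-(s + t) * (1 - Real.cos θ)) * (1 + Real.cos θ) *
      angularKernel (t - s) θ * angularWeight e κ s θ)
    (F' := fun s θ => Real.exp (-(s + t) * (1 - Real.cos θ)) * (1 + Real.cos θ) *
      sincMul (t - s) (Real.sin θ) * angularWeight e κ s θ
      - Real.exp (-(s + t) * (1 - Real.cos θ)) * (1 + Real.cos θ) *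
      angularKernel (t - s) θ * angularWeight e κ s θ
      + 2 * e s * (Real.exp (-(t - s) * (1 - Real.cos θ)) * (1 + Real.cos θ) *
      angularKernel (t - s) θ))
    (by simp only [Function.uncurry_def]; fun_prop)
    (by simp only [Function.uncurry_def]; fun_prop)
    (fun s θ => by
      have h1 := (((((hasDerivAt_id s).add_const t).neg).mul_const (1 - Real.cos θ)).exp)
      have h2 := (hasDerivAt_angularKernel θ (t - s)).comp s ((hasDerivAt_id s).const_sub t)
      refine (((h1.mul_const (1 + Real.cos θ)).mul h2).mul
        (hasDerivAt_angularWeight κ he s θ)).congr_deriv ?_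
      simp only [id, Pi.neg_apply, Pi.mul_apply, Function.comp]
      rw [show -(t - s) * (1 - Real.cos θ) = -(s + t) * (1 - Real.cos θ) +
        2 * s * (1 - Real.cos θ) by ring, Real.exp_add]
      ring) s
  -- Differentiating the weight contributes `2 * e s`, because the kernel integrates to `π`; with
  -- the `-e s` from the moving endpoint this leaves the source `e s`.
  refine (hE.add (hI.const_mul Real.pi⁻¹)).congr_deriv ?_
  rw [intervalIntegral.integral_add, intervalIntegral.integral_sub,
    intervalIntegral.integral_const_mul, integral_angularKernel, residualMajorant, distMajorant]
  · field_simp [Real.pi_ne_zero]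
    ring
  all_goals exact Continuous.intervalIntegrable (by fun_prop) _ _

theorem le_residualMajorant_zero (he0 : ∀ q, 0 ≤ e q) {t : ℝ} (ht : 0 ≤ t) :
    κ ≤ residualMajorant e κ 0 t := by
  have h := intervalIntegral.integral_nonneg (μ := volume) ht fun q _ => he0 q
  have : residualMajorant e κ 0 t = (∫ q in (0 : ℝ)..t, e q) + κ := by
    simp only [residualMajorant, angularWeight, intervalIntegral.integral_same, zero_add,
      sub_zero, mul_zero, add_zero, intervalIntegral.integral_mul_const, integral_angularKernel]
    field_simp [Real.pi_ne_zero]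
  linarith

end Majorant

/-! ### The decay profile and the majorant on the diagonal. -/

/-- The decay profile `π⁻¹ ∫₀^π exp (-2y(1 - cos θ)) (1 + cos θ) dθ`. -/
noncomputable def decayProfile (y : ℝ) : ℝ :=
  Real.pi⁻¹ * ∫ θ in (0 : ℝ)..Real.pi, Real.exp (-(2 * y) * (1 - Real.cos θ)) * (1 + Real.cos θ)

theorem continuous_decayProfile : Continuous decayProfile := by
  unfold decayProfile
  refine continuous_const.mul
    (intervalIntegral.continuous_parametric_intervalIntegral_of_continuous'
    (f := fun y θ => Real.exp (-(2 * y) * (1 - Real.cos θ)) * (1 + Real.cos θ)) ?_ _ _)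
  simp only [Function.uncurry_def]; fun_prop

theorem decayProfile_nonneg (y : ℝ) : 0 ≤ decayProfile y := by
  refine mul_nonneg (by positivity) (intervalIntegral.integral_nonneg Real.pi_pos.le fun θ _ => ?_)
  have := Real.neg_one_le_cos θ
  exact mul_nonneg (Real.exp_pos _).le (by linarith)

theorem decayProfile_le_one {y : ℝ} (hy : 0 ≤ y) : decayProfile y ≤ 1 := by
  have : ∫ θ in (0 : ℝ)..Real.pi, Real.exp (-(2 * y) * (1 - Real.cos θ)) * (1 + Real.cos θ) ≤
      ∫ θ in (0 : ℝ)..Real.pi, (1 + Real.cos θ) := by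
    refine intervalIntegral.integral_mono_on Real.pi_pos.le
      (Continuous.intervalIntegrable (by fun_prop) _ _)
      (Continuous.intervalIntegrable (by fun_prop) _ _) fun θ _ => ?_
    have h1 := Real.neg_one_le_cos θ
    have h2 := Real.cos_le_one θ
    refine mul_le_of_le_one_left (by linarith) (Real.exp_le_one_iff.2 ?_)
    nlinarith
  rw [intervalIntegral.integral_add (by simp)
    (Continuous.intervalIntegrable (by fun_prop) _ _)] at this
  simp at this
  rw [decayProfile, inv_mul_le_iff₀ Real.pi_pos]
  simpa using this

/-- Half-angle formulas give `1 - cos θ = 2 sin²(θ/2)` and `1 + cos θ = 2 cos²(θ/2) ≤ 2 cos(θ/2)`.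
The substitution `z = 2 sin(θ/2)` then bounds the integral by twice a Gaussian integral on `[0, 2]`,
which is at most the one on the half-line. -/
theorem decayProfile_le {y : ℝ} (hy : 0 < y) : decayProfile y ≤ 1 / √(Real.pi * y) := by
  have h1 : ∫ θ in (0 : ℝ)..Real.pi, Real.exp (-(2 * y) * (1 - Real.cos θ)) * (1 + Real.cos θ) ≤
      ∫ θ in (0 : ℝ)..Real.pi, 2 * ((fun z => Real.exp (-y * z ^ 2)) ∘ fun θ =>
        2 * Real.sin (θ / 2)) θ * Real.cos (θ / 2) := by
    refine intervalIntegral.integral_mono_on Real.pi_pos.le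
      (Continuous.intervalIntegrable (by fun_prop) _ _)
      (Continuous.intervalIntegrable (by fun_prop) _ _) fun θ hθ => ?_
    have e1 : Real.cos θ = 2 * Real.cos (θ / 2) ^ 2 - 1 := by
      rw [← Real.cos_two_mul]; ring_nf
    have hc0 : 0 ≤ Real.cos (θ / 2) :=
      Real.cos_nonneg_of_mem_Icc ⟨by linarith [hθ.1, Real.pi_pos], by linarith [hθ.2]⟩
    have hc1 := Real.cos_le_one (θ / 2)
    have e2 : -(2 * y) * (1 - Real.cos θ) = -y * (2 * Real.sin (θ / 2)) ^ 2 := by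
      rw [e1]; linear_combination (4 * y) * Real.sin_sq_add_cos_sq (θ / 2)
    simp only [Function.comp]
    rw [e2]
    have := Real.exp_pos (-y * (2 * Real.sin (θ / 2)) ^ 2)
    rw [mul_comm 2 (Real.exp _), mul_assoc]
    refine mul_le_mul_of_nonneg_left ?_ this.le
    rw [e1]; nlinarith
  have h2 : ∫ θ in (0 : ℝ)..Real.pi, 2 * ((fun z => Real.exp (-y * z ^ 2)) ∘ fun θ =>
        2 * Real.sin (θ / 2)) θ * Real.cos (θ / 2) = 2 * ∫ z in (0 : ℝ)..2, Real.exp (-y * z ^ 2) := by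
    have := intervalIntegral.integral_comp_mul_deriv (a := 0) (b := Real.pi)
      (f := fun θ => 2 * Real.sin (θ / 2)) (f' := fun θ => Real.cos (θ / 2))
      (g := fun z => Real.exp (-y * z ^ 2)) (fun θ _ => by
        refine ((((hasDerivAt_id θ).div_const 2).sin).const_mul 2).congr_deriv ?_
        simp only [id]; ring) (by fun_prop) (by fun_prop)
    simp only [zero_div, Real.sin_zero, mul_zero, Real.sin_pi_div_two, mul_one] at this
    rw [← this, ← intervalIntegral.integral_const_mul]
    simp only [mul_assoc]
  have h3 : ∫ z in (0 : ℝ)..2, Real.exp (-y * z ^ 2) ≤ √(Real.pi / y) / 2 := by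
    rw [← integral_gaussian_Ioi, intervalIntegral.integral_of_le (by norm_num)]
    exact setIntegral_mono_set (integrable_exp_neg_mul_sq hy).integrableOn
      (Eventually.of_forall fun z => (Real.exp_pos _).le) (Ioc_subset_Ioi_self).eventuallyLE
  have h4 : Real.pi⁻¹ * √(Real.pi / y) = 1 / √(Real.pi * y) := by
    rw [Real.sqrt_div Real.pi_pos.le, Real.sqrt_mul Real.pi_pos.le]
    have := Real.mul_self_sqrt Real.pi_pos.le
    have h5 := Real.sqrt_pos.2 Real.pi_pos
    have h6 := Real.sqrt_pos.2 hy
    have := Real.pi_pos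
    field_simp
    linarith [Real.sq_sqrt Real.pi_pos.le]
  rw [← h4, decayProfile]
  refine mul_le_mul_of_nonneg_left ?_ (by positivity)
  linarith

/-- At `s = t` the kernel is identically `1`; combining the exponentials and exchanging the
integrals over angle and time produces a convolution. -/
theorem residualMajorant_self {e : ℝ → ℝ} (κ : ℝ) (he : Continuous e) {t : ℝ} :
    residualMajorant e κ t t =
      κ * decayProfile t + 2 * ∫ q in (0 : ℝ)..t, decayProfile (t - q) * e q := by
  have hswap : ∫ q in (0 : ℝ)..t, ∫ θ in (0 : ℝ)..Real.pi,
      Real.exp (-(2 * (t - q)) * (1 - Real.cos θ)) * (1 + Real.cos θ) * e q =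
      ∫ θ in (0 : ℝ)..Real.pi, ∫ q in (0 : ℝ)..t,
      Real.exp (-(2 * (t - q)) * (1 - Real.cos θ)) * (1 + Real.cos θ) * e q := by
    refine intervalIntegral_intervalIntegral_swap ?_
    have hc : Continuous (Function.uncurry fun q θ : ℝ =>
        Real.exp (-(2 * (t - q)) * (1 - Real.cos θ)) * (1 + Real.cos θ) * e q) := by
      simp only [Function.uncurry_def]; fun_prop
    exact (hc.continuousOn.integrableOn_compact
      (isCompact_uIcc.prod isCompact_uIcc)).mono_set
      (prod_mono uIoc_subset_uIcc uIoc_subset_uIcc)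
  have hW : Continuous fun θ : ℝ => angularWeight e κ t θ :=
    he.angularWeight κ continuous_const continuous_id
  have hL : ∫ q in (0 : ℝ)..t, decayProfile (t - q) * e q = Real.pi⁻¹ *
      ∫ θ in (0 : ℝ)..Real.pi, ∫ q in (0 : ℝ)..t,
      Real.exp (-(2 * (t - q)) * (1 - Real.cos θ)) * (1 + Real.cos θ) * e q := by
    rw [← hswap, ← intervalIntegral.integral_const_mul]
    congr 1; ext q
    rw [decayProfile, mul_assoc, intervalIntegral.integral_mul_const]
  have hin : ∀ θ, Real.exp (-(t + t) * (1 - Real.cos θ)) * (1 + Real.cos θ) *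
      angularKernel (t - t) θ * angularWeight e κ t θ =
      κ * (Real.exp (-(2 * t) * (1 - Real.cos θ)) * (1 + Real.cos θ)) +
      2 * ∫ q in (0 : ℝ)..t,
        Real.exp (-(2 * (t - q)) * (1 - Real.cos θ)) * (1 + Real.cos θ) * e q := by
    intro θ
    have : ∫ q in (0 : ℝ)..t,
        Real.exp (-(2 * (t - q)) * (1 - Real.cos θ)) * (1 + Real.cos θ) * e q =
        Real.exp (-(2 * t) * (1 - Real.cos θ)) * (1 + Real.cos θ) *
        ∫ q in (0 : ℝ)..t, Real.exp (2 * q * (1 - Real.cos θ)) * e q := by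
      rw [← intervalIntegral.integral_const_mul]
      congr 1; ext q
      rw [show -(2 * (t - q)) * (1 - Real.cos θ) = -(2 * t) * (1 - Real.cos θ) +
        2 * q * (1 - Real.cos θ) by ring, Real.exp_add]
      ring
    rw [this, angularWeight, angularKernel]
    simp only [sub_self, zero_mul, Real.cos_zero, sincMul_zero_left, mul_zero, add_zero, mul_one]
    rw [show -(t + t) = -(2 * t) by ring]
    ring
  rw [hL, residualMajorant, decayProfile]
  simp only [hin, intervalIntegral.integral_same, zero_add]
  rw [intervalIntegral.integral_add, intervalIntegral.integral_const_mul,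
    intervalIntegral.integral_const_mul]
  · ring
  · exact Continuous.intervalIntegrable (by fun_prop) _ _
  · refine Continuous.intervalIntegrable (continuous_const.mul ?_) _ _
    exact intervalIntegral.continuous_parametric_intervalIntegral_of_continuous'
      (f := fun θ q => Real.exp (-(2 * (t - q)) * (1 - Real.cos θ)) * (1 + Real.cos θ) * e q)
      (by simp only [Function.uncurry_def]; fun_prop) _ _

/-! ### Comparison of the solution with the majorants. -/

section Comparison

variable {X : Type*} [NormedAddCommGroup X] [NormedSpace ℝ X] {T : X → X} {f : ℝ → X} {x₀ : X}
  {u : ℝ → X} {e : ℝ → ℝ} {κ : ℝ}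

theorem IsEvolutionSolution.hasDerivWithinAt (hu : IsEvolutionSolution T f x₀ u) {t : ℝ}
    (ht : 0 ≤ t) : HasDerivWithinAt u (f t - (u t - T (u t))) (Ici 0) t := by
  obtain ⟨v, hv, hvt⟩ := hu.equation t ht
  rwa [← hvt, add_sub_cancel_right]

theorem IsEvolutionSolution.continuousOn (hu : IsEvolutionSolution T f x₀ u) :
    ContinuousOn u (Ici 0) :=
  fun _ ht => (hu.hasDerivWithinAt ht).continuousWithinAt

theorem IsEvolutionSolution.deriv_eq (hu : IsEvolutionSolution T f x₀ u) {t : ℝ} (ht : 0 < t) :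
    deriv u t = f t + (T (u t) - u t) := by
  rw [((hu.hasDerivWithinAt ht.le).hasDerivAt (Ici_mem_nhds ht)).deriv]
  abel

theorem IsEvolutionSolution.hasDerivWithinAt_exp_smul_sub (hu : IsEvolutionSolution T f x₀ u)
    (c : X) {t : ℝ} (ht : 0 ≤ t) : HasDerivWithinAt (fun t => Real.exp t • (u t - c))
      (Real.exp t • (T (u t) - c + f t)) (Ici t) t := by
  have h := ((hu.hasDerivWithinAt ht).mono (Ici_subset_Ici.2 ht)).sub_const c
  refine ((Real.hasDerivAt_exp t).hasDerivWithinAt.smul h).congr_deriv ?_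
  rw [← smul_add]
  congr 1
  abel

theorem IsEvolutionSolution.continuousOn_exp_smul_sub (hu : IsEvolutionSolution T f x₀ u)
    (c : X) {a b : ℝ} (ha : 0 ≤ a) : ContinuousOn (fun t => Real.exp t • (u t - c)) (Icc a b) :=
  Real.continuous_exp.continuousOn.smul
    ((hu.continuousOn.mono fun _ hx => ha.trans hx.1).sub continuousOn_const)

theorem norm_exp_smul (t : ℝ) (x : X) : ‖Real.exp t • x‖ = Real.exp t * ‖x‖ := by
  rw [norm_smul, Real.norm_of_nonneg (Real.exp_pos t).le]

/-- First half of an iteration pass: with `s` fixed, integrating forward from the diagonal does not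
enlarge the error `N`. -/
theorem norm_sub_le_of_norm_residual_le (hu : IsEvolutionSolution T f x₀ u) (he : Continuous e)
    (hfe : ∀ t, 0 ≤ t → ‖f t‖ ≤ e t) {N s t : ℝ} (hN : 0 ≤ N) (hs : 0 ≤ s) (hst : s ≤ t)
    (h : ∀ r ∈ Icc s t, ‖T (u r) - u s‖ ≤ residualMajorant e κ s r + N) :
    ‖u t - u s‖ ≤ distMajorant e κ s t + N := by
  have key := image_norm_le_of_norm_deriv_right_le_deriv_boundary
    (hu.continuousOn_exp_smul_sub (u s) (b := t) hs)
    (fun r hr => hu.hasDerivWithinAt_exp_smul_sub (u s) (hs.trans hr.1))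
    (B := fun r => Real.exp r * (distMajorant e κ s r + N))
    (B' := fun r => Real.exp r * (residualMajorant e κ s r + e r + N))
    (by simpa [distMajorant_self] using mul_nonneg (Real.exp_pos s).le hN)
    (fun r => by
      refine ((Real.hasDerivAt_exp r).mul
        ((hasDerivAt_distMajorant κ he s r).add_const N)).congr_deriv ?_
      ring)
    (fun r hr => by
      rw [norm_exp_smul]
      refine mul_le_mul_of_nonneg_left ?_ (Real.exp_pos r).le
      have := norm_add_le (T (u r) - u s) (f r)
      linarith [h r ⟨hr.1, hr.2.le⟩, hfe r (hs.trans hr.1)])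
    (right_mem_Icc.2 hst)
  rw [norm_exp_smul] at key
  exact le_of_mul_le_mul_left key (Real.exp_pos t)

/-- Second half of the pass, with `t` fixed and `s` running up from `0`. The initial value carries
no error, so `M` enters only through the derivative and is damped; the bound `R` on the times makes
the damping factor uniform. -/
theorem norm_residual_le_of_norm_sub_le (hT : LipschitzWith 1 T)
    (hu : IsEvolutionSolution T f x₀ u) (he : Continuous e) (he0 : ∀ q, 0 ≤ e q)
    (hfe : ∀ t, 0 ≤ t → ‖f t‖ ≤ e t) (hκ : ∀ t, 0 ≤ t → ‖T (u t) - x₀‖ ≤ κ)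
    {M R s t : ℝ} (hM : 0 ≤ M) (hs : 0 ≤ s) (hst : s ≤ t) (htR : t ≤ R)
    (h : ∀ q ∈ Icc 0 t, ‖u t - u q‖ ≤ distMajorant e κ q t + M) :
    ‖T (u t) - u s‖ ≤ residualMajorant e κ s t + (1 - Real.exp (-R)) * M := by
  have key := image_norm_le_of_norm_deriv_right_le_deriv_boundary
    (hu.continuousOn_exp_smul_sub (T (u t)) (b := t) le_rfl)
    (fun r hr => hu.hasDerivWithinAt_exp_smul_sub (T (u t)) hr.1)
    -- Subtracting `M` cancels the error at `r = 0`. After division by `exp s` the remaining error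
    -- is `(1 - exp (-s)) * M`.
    (B := fun r => Real.exp r * (residualMajorant e κ r t + M) - M)
    (B' := fun r => Real.exp r * (distMajorant e κ r t + e r + M))
    (by
      have h1 := le_residualMajorant_zero κ he0 (hs.trans hst)
      have h2 := hκ t (hs.trans hst)
      rw [norm_exp_smul, hu.initial, norm_sub_rev]
      simp only [Real.exp_zero, one_mul]
      linarith)
    (fun r => by
      refine (((Real.hasDerivAt_exp r).mul
        ((hasDerivAt_residualMajorant κ he r t).add_const M)).sub_const M).congr_deriv ?_
      ring)
    (fun r hr => by
      rw [norm_exp_smul]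
      refine mul_le_mul_of_nonneg_left ?_ (Real.exp_pos r).le
      have h1 := norm_add_le (T (u r) - T (u t)) (f r)
      have h2 : ‖T (u r) - T (u t)‖ ≤ ‖u t - u r‖ := by
        have := hT.dist_le_mul (u r) (u t)
        rwa [NNReal.coe_one, one_mul, dist_eq_norm, dist_eq_norm, norm_sub_rev (u r)] at this
      linarith [h r ⟨hr.1, hr.2.le⟩, hfe r hr.1])
    ⟨hs, hst⟩
  rw [norm_exp_smul, norm_sub_rev] at key
  have h1 : Real.exp s * ‖T (u t) - u s‖ ≤
      Real.exp s * (residualMajorant e κ s t + (1 - Real.exp (-s)) * M) := by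
    refine key.trans_eq ?_
    have : Real.exp s * Real.exp (-s) = 1 := by rw [← Real.exp_add]; simp
    linear_combination M * this
  have h2 := le_of_mul_le_mul_left h1 (Real.exp_pos s)
  have h3 : Real.exp (-R) ≤ Real.exp (-s) := Real.exp_le_exp.2 (by linarith)
  nlinarith

theorem norm_residual_le (hT : LipschitzWith 1 T)
    (hu : IsEvolutionSolution T f x₀ u) (he : Continuous e) (he0 : ∀ q, 0 ≤ e q)
    (hfe : ∀ t, 0 ≤ t → ‖f t‖ ≤ e t) (hκ : ∀ t, 0 ≤ t → ‖T (u t) - x₀‖ ≤ κ)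
    {t : ℝ} (ht : 0 ≤ t) : ‖T (u t) - u t‖ ≤ residualMajorant e κ t t := by
  set θ := 1 - Real.exp (-t)
  have hθ0 : 0 ≤ θ := sub_nonneg.2 (Real.exp_le_one_iff.2 (by linarith))
  have hθ1 : θ < 1 := sub_lt_self _ (Real.exp_pos _)
  have hcont : ContinuousOn (fun p : ℝ × ℝ => ‖u p.2 - u p.1‖ - distMajorant e κ p.1 p.2)
      (Icc 0 t ×ˢ Icc 0 t) := by
    refine ContinuousOn.sub (ContinuousOn.norm (ContinuousOn.sub ?_ ?_))
      (continuous_distMajorant κ he).continuousOn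
    · exact hu.continuousOn.comp continuousOn_snd fun p hp => hp.2.1
    · exact hu.continuousOn.comp continuousOn_fst fun p hp => hp.1.1
  -- Compactness supplies a crude initial error `C`; each pass then multiplies it by `θ < 1`.
  obtain ⟨C, hC⟩ := (isCompact_Icc.prod isCompact_Icc).exists_bound_of_continuousOn hcont
  have hC0 : 0 ≤ C := (norm_nonneg _).trans (hC (0, 0) ⟨⟨le_rfl, ht⟩, ⟨le_rfl, ht⟩⟩)
  have hD : ∀ n : ℕ, ∀ s r, 0 ≤ s → s ≤ r → r ≤ t →
      ‖u r - u s‖ ≤ distMajorant e κ s r + θ ^ n * C := by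
    intro n
    induction n with
    | zero =>
      intro s r hs hsr hr
      have := (le_abs_self _).trans (hC (s, r) ⟨⟨hs, hsr.trans hr⟩, ⟨hs.trans hsr, hr⟩⟩)
      simp only [pow_zero, one_mul]
      linarith
    | succ n ih =>
      intro s r hs hsr hr
      refine norm_sub_le_of_norm_residual_le hu he hfe (by positivity) hs hsr fun r' hr' => ?_
      rw [pow_succ', mul_assoc]
      exact norm_residual_le_of_norm_sub_le hT hu he he0 hfe hκ (by positivity) hs hr'.1
        (hr'.2.trans hr) fun q hq => ih q r' hq.1 hq.2 (hr'.2.trans hr)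
  have hG : ∀ n : ℕ, ‖T (u t) - u t‖ ≤ residualMajorant e κ t t + θ * (θ ^ n * C) := fun n =>
    norm_residual_le_of_norm_sub_le hT hu he he0 hfe hκ (by positivity) ht le_rfl le_rfl
      fun q hq => hD n q t hq.1 hq.2 le_rfl
  have hlim : Tendsto (fun n : ℕ => residualMajorant e κ t t + θ * (θ ^ n * C)) atTop
      (nhds (residualMajorant e κ t t + θ * (0 * C))) :=
    (((tendsto_pow_atTop_nhds_zero_of_lt_one hθ0 hθ1).mul_const C).const_mul θ).const_add _
  simpa using ge_of_tendsto' hlim hG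

theorem norm_deriv_le (hT : LipschitzWith 1 T) (hu : IsEvolutionSolution T f x₀ u)
    (he : Continuous e) (he0 : ∀ q, 0 ≤ e q)
    (hfe : ∀ t, 0 ≤ t → ‖f t‖ ≤ e t) (hκ : ∀ t, 0 ≤ t → ‖T (u t) - x₀‖ ≤ κ)
    {t : ℝ} (ht : 0 < t) : ‖deriv u t‖ ≤
      e t + κ * decayProfile t + 2 * ∫ q in (0 : ℝ)..t, decayProfile (t - q) * e q := by
  rw [hu.deriv_eq ht]
  have h := norm_residual_le hT hu he he0 hfe hκ ht.le
  rw [residualMajorant_self κ he] at h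
  linarith [norm_add_le (f t) (T (u t) - u t), hfe t ht.le]

/-- Nonexpansiveness gives `‖T (u r) - p‖ ≤ ‖u r - p‖`, so only the forcing can increase the
distance to `p`. The slack `η * r` makes the comparison strict, so that it need be checked only at
contact with the barrier; then `δ → 0`. -/
theorem norm_sub_fixedPoint_le (hT : LipschitzWith 1 T) (hu : IsEvolutionSolution T f x₀ u)
    (he : Continuous e) (hfe : ∀ t, 0 ≤ t → ‖f t‖ ≤ e t)
    {p : X} (hp : T p = p) {t : ℝ} (ht : 0 ≤ t) :
    ‖u t - p‖ ≤ ‖x₀ - p‖ + ∫ q in (0 : ℝ)..t, e q := by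
  refine le_of_forall_pos_le_add fun δ hδ => ?_
  set η := δ / (t + 1)
  have hη : 0 < η := by positivity
  have key := image_norm_le_of_norm_deriv_right_lt_deriv_boundary
    (hu.continuousOn_exp_smul_sub p (b := t) le_rfl)
    (fun r hr => hu.hasDerivWithinAt_exp_smul_sub p hr.1)
    (B := fun r => Real.exp r * (‖x₀ - p‖ + (∫ q in (0 : ℝ)..r, e q) + η * r))
    (B' := fun r => Real.exp r * (‖x₀ - p‖ + (∫ q in (0 : ℝ)..r, e q) + η * r) +
      Real.exp r * (e r + η))
    (by simp [hu.initial])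
    (fun r => by
      refine ((Real.hasDerivAt_exp r).mul ((((he.integral_hasStrictDerivAt 0 r).hasDerivAt).const_add
        ‖x₀ - p‖).add ((hasDerivAt_id r).const_mul η))).congr_deriv ?_
      simp)
    (fun r hr h => by
      rw [← h, norm_exp_smul, norm_exp_smul, ← mul_add]
      refine mul_lt_mul_of_pos_left ?_ (Real.exp_pos r)
      have h1 := norm_add_le (T (u r) - p) (f r)
      have h2 : ‖T (u r) - p‖ ≤ ‖u r - p‖ := by
        have := hT.dist_le_mul (u r) p
        rwa [NNReal.coe_one, one_mul, dist_eq_norm, dist_eq_norm, hp] at this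
      linarith [hfe r hr.1])
    (right_mem_Icc.2 ht)
  rw [norm_exp_smul] at key
  have h1 := le_of_mul_le_mul_left key (Real.exp_pos t)
  have h2 : η * t ≤ δ := by
    rw [div_mul_eq_mul_div, div_le_iff₀ (by linarith)]
    nlinarith
  linarith

end Comparison

/-! ### Estimates for the error bound and its convolution with the profile. -/

theorem IsErrorBound.nonneg {X : Type*} [NormedAddCommGroup X] {f : ℝ → X} {ε : ℝ → ℝ}
    (hε : IsErrorBound f ε) {t : ℝ} (ht : 0 ≤ t) : 0 ≤ ε t :=
  (norm_nonneg _).trans (hε.norm_le t ht)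

/-- Freezing `ε` at `ε 0` for negative times provides the globally continuous `e` that the majorants
require. -/
theorem IsErrorBound.continuous_comp_max {X : Type*} [NormedAddCommGroup X] {f : ℝ → X}
    {ε : ℝ → ℝ} (hε : IsErrorBound f ε) : Continuous fun q => ε (max 0 q) :=
  hε.continuousOn.comp_continuous (by fun_prop) fun q => le_max_left 0 q

/-- For `q ≤ t/2` the argument `t - q` is at least `t/2`, so the profile is at most `1/√(πt/2)`.
This is the origin of the `2√2 S` in `ν`. -/
theorem integral_decayProfile_mul_le {e : ℝ → ℝ} (he : Continuous e) (he0 : ∀ q, 0 ≤ e q)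
    {t : ℝ} (ht : 0 < t) : ∫ q in (0 : ℝ)..t, decayProfile (t - q) * e q ≤
      √2 / √(Real.pi * t) * (∫ q in (0 : ℝ)..t / 2, e q) +
        ∫ q in t / 2..t, decayProfile (t - q) * e q := by
  have hc : Continuous fun q => decayProfile (t - q) * e q :=
    (continuous_decayProfile.comp (by fun_prop)).mul he
  rw [← intervalIntegral.integral_add_adjacent_intervals (b := t / 2)
    (hc.intervalIntegrable _ _) (hc.intervalIntegrable _ _), ← intervalIntegral.integral_const_mul]
  refine add_le_add_left (intervalIntegral.integral_mono_on (by linarith)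
    (hc.intervalIntegrable _ _) ((continuous_const.mul he).intervalIntegrable _ _)
    fun q hq => mul_le_mul_of_nonneg_right ?_ (he0 q)) _
  have h1 : √2 / √(Real.pi * t) = 1 / √(Real.pi * (t / 2)) := by
    rw [← mul_div_assoc, Real.sqrt_div (by positivity), one_div_div]
  rw [h1]
  refine (decayProfile_le (by linarith [hq.2])).trans ?_
  have := Real.pi_pos
  refine one_div_le_one_div_of_le (by positivity) (Real.sqrt_le_sqrt ?_)
  nlinarith [hq.2]

theorem integral_decayProfile_le {x : ℝ} (hx : 0 ≤ x) :
    ∫ y in (0 : ℝ)..x, decayProfile y ≤ 2 * √x := by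
  have h1 : ∫ y in (0 : ℝ)..x, decayProfile y ≤ ∫ y in (0 : ℝ)..x, y ^ (-(1 / 2) : ℝ) := by
    refine intervalIntegral.integral_mono_on_of_le_Ioo hx
      (continuous_decayProfile.intervalIntegrable _ _)
      (intervalIntegral.intervalIntegrable_rpow' (by norm_num)) fun y hy => ?_
    have hy0 := hy.1
    refine (decayProfile_le hy0).trans ?_
    rw [Real.rpow_neg hy0.le, ← Real.sqrt_eq_rpow, ← one_div]
    refine one_div_le_one_div_of_le (by positivity) (Real.sqrt_le_sqrt ?_)
    nlinarith [Real.pi_gt_three]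
  rw [integral_rpow (Or.inl (by norm_num))] at h1
  norm_num at h1
  rw [← Real.sqrt_eq_rpow] at h1
  linarith

section ErrorBound

variable {X : Type*} [NormedAddCommGroup X] {T : X → X} {f : ℝ → X} {ε : ℝ → ℝ}

theorem HypFixedPoint.integral_le_totalError (h : HypFixedPoint T ε) (hε : IsErrorBound f ε)
    {t : ℝ} (ht : 0 ≤ t) : ∫ q in (0 : ℝ)..t, ε q ≤ totalError ε := by
  rw [intervalIntegral.integral_of_le ht]
  exact setIntegral_mono_set h.integrableOn
    ((ae_restrict_iff' measurableSet_Ioi).2 (Eventually.of_forall fun q hq => hε.nonneg (le_of_lt hq)))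
    Ioc_subset_Ioi_self.eventuallyLE

theorem HypBoundedRange.exists_norm_sub_le (h : HypBoundedRange T) (x₀ : X) :
    ∃ κ, ∀ x, ‖T x - x₀‖ ≤ κ := by
  obtain ⟨C, hC⟩ := h.exists_norm_le
  exact ⟨C + ‖x₀‖, fun x => (norm_sub_le _ _).trans (by linarith [hC (T x) (mem_range_self x)])⟩

theorem totalError_nonneg (hε : IsErrorBound f ε) : 0 ≤ totalError ε :=
  setIntegral_nonneg measurableSet_Ioi fun _ hs => hε.nonneg (le_of_lt hs)

theorem exists_integral_le_of_isBigO (hε : IsErrorBound f ε) {a : ℝ}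
    (hO : ε =O[atTop] (fun t : ℝ => 1 / t ^ a)) : ∃ B C N : ℝ, 0 ≤ C ∧ 1 ≤ N ∧ ∀ x, N ≤ x →
      0 ≤ ∫ q in (0 : ℝ)..x, ε q ∧
      ∫ q in (0 : ℝ)..x, ε q ≤ B + C * ∫ q in N..x, q ^ (-a) := by
  obtain ⟨C, hC0, hC⟩ := hO.exists_pos
  obtain ⟨N, hN⟩ := eventually_atTop.1 hC.bound
  have hI : ∀ x y : ℝ, 0 ≤ x → x ≤ y → IntervalIntegrable ε volume x y := fun x y hx hxy =>
    (hε.continuousOn.mono fun q hq => hx.trans hq.1).intervalIntegrable_of_Icc hxy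
  -- The cut-off at least `1` keeps the power `q ^ (-a)` away from its singularity at `0`.
  refine ⟨∫ q in (0 : ℝ)..max 1 N, ε q, C, max 1 N, hC0.le, le_max_left _ _, fun x hx => ?_⟩
  have h1 : (1 : ℝ) ≤ max 1 N := le_max_left _ _
  refine ⟨intervalIntegral.integral_nonneg (by linarith) fun q hq => hε.nonneg hq.1, ?_⟩
  rw [← intervalIntegral.integral_add_adjacent_intervals (hI 0 _ le_rfl (by linarith))
    (hI (max 1 N) x (by linarith) hx), ← intervalIntegral.integral_const_mul]
  refine add_le_add_right (intervalIntegral.integral_mono_on hx (hI _ _ (by linarith) hx) ?_ ?_) _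
  · refine (intervalIntegral.intervalIntegrable_rpow (Or.inr ?_)).const_mul C
    rw [uIcc_of_le hx]
    exact fun h => by linarith [h.1]
  · intro q hq
    have hq0 : 0 < q := by linarith [hq.1]
    have h2 := (le_abs_self _).trans (hN q ((le_max_right _ _).trans hq.1))
    rwa [Real.norm_of_nonneg (by positivity), one_div, ← Real.rpow_neg hq0.le] at h2

theorem isBigO_integral_of_lt_one (hε : IsErrorBound f ε) {a : ℝ} (ha : a < 1)
    (hO : ε =O[atTop] (fun t : ℝ => 1 / t ^ a)) :
    (fun t => ∫ q in (0 : ℝ)..t / 2, ε q) =O[atTop] fun t : ℝ => t ^ (1 - a) := by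
  obtain ⟨B, C, N, hC, hN, h⟩ := exists_integral_le_of_isBigO hε hO
  refine IsBigO.of_bound (|B| + C / (1 - a)) ?_
  filter_upwards [eventually_ge_atTop (2 * N)] with t ht
  have ha' : 0 < 1 - a := by linarith
  obtain ⟨h0, h1⟩ := h (t / 2) (by linarith)
  rw [integral_rpow (Or.inl (by linarith)), show -a + 1 = 1 - a by ring] at h1
  rw [Real.norm_of_nonneg h0, Real.norm_of_nonneg (Real.rpow_nonneg (by linarith) _), add_mul]
  refine h1.trans (add_le_add ?_ ?_)
  · exact (le_abs_self B).trans (le_mul_of_one_le_right (abs_nonneg B)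
      (Real.one_le_rpow (by linarith) ha'.le))
  · rw [div_mul_eq_mul_div, mul_div_assoc]
    have h2 : (t / 2) ^ (1 - a) ≤ t ^ (1 - a) :=
      Real.rpow_le_rpow (by linarith) (by linarith) ha'.le
    have h3 : 0 ≤ N ^ (1 - a) := Real.rpow_nonneg (by linarith) _
    gcongr
    linarith

theorem isBigO_integral_of_eq_one (hε : IsErrorBound f ε)
    (hO : ε =O[atTop] (fun t : ℝ => 1 / t ^ (1 : ℝ))) :
    (fun t => ∫ q in (0 : ℝ)..t / 2, ε q) =O[atTop] Real.log := by
  obtain ⟨B, C, N, hC, hN, h⟩ := exists_integral_le_of_isBigO hε hO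
  refine IsBigO.of_bound (|B| + C) ?_
  filter_upwards [eventually_ge_atTop (2 * N), eventually_ge_atTop (Real.exp 1)] with t ht ht1
  have hlog : 1 ≤ Real.log t := by
    rwa [Real.le_log_iff_exp_le (by linarith)]
  obtain ⟨h0, h1⟩ := h (t / 2) (by linarith)
  simp only [Real.rpow_neg_one] at h1
  rw [integral_inv_of_pos (by linarith) (by linarith)] at h1
  rw [Real.norm_of_nonneg h0, Real.norm_of_nonneg (by linarith), add_mul]
  refine h1.trans (add_le_add ?_ (mul_le_mul_of_nonneg_left ?_ hC))
  · exact (le_abs_self B).trans (le_mul_of_one_le_right (abs_nonneg B) hlog)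
  · refine Real.log_le_log (by apply div_pos <;> linarith) ?_
    exact (div_le_self (by linarith) hN).trans (by linarith)

theorem isBigO_integral_of_one_lt (hε : IsErrorBound f ε) {a : ℝ} (ha : 1 < a)
    (hO : ε =O[atTop] (fun t : ℝ => 1 / t ^ a)) :
    (fun t => ∫ q in (0 : ℝ)..t / 2, ε q) =O[atTop] fun _ : ℝ => (1 : ℝ) := by
  obtain ⟨B, C, N, hC, hN, h⟩ := exists_integral_le_of_isBigO hε hO
  refine IsBigO.of_bound (B + C * (N ^ (1 - a) / (a - 1))) ?_
  filter_upwards [eventually_ge_atTop (2 * N)] with t ht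
  obtain ⟨h0, h1⟩ := h (t / 2) (by linarith)
  rw [integral_rpow (Or.inr ⟨by linarith, by
    rw [uIcc_of_le (by linarith)]; exact fun h => by linarith [h.1]⟩),
    show -a + 1 = 1 - a by ring] at h1
  rw [Real.norm_of_nonneg h0, norm_one, mul_one]
  refine h1.trans (add_le_add_right (mul_le_mul_of_nonneg_left ?_ hC) _)
  rw [← neg_div_neg_eq, neg_sub, neg_sub]
  have : 0 ≤ (t / 2) ^ (1 - a) := Real.rpow_nonneg (by linarith) _
  have ha' : 0 < a - 1 := by linarith
  gcongr
  linarith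

theorem nuConst_nonneg (T : X → X) (x₀ : X) (hε : IsErrorBound f ε) : 0 ≤ nuConst T x₀ ε := by
  have := totalError_nonneg hε
  have := Metric.infDist_nonneg (x := x₀) (s := Function.fixedPoints T)
  unfold nuConst kappaConst
  positivity

end ErrorBound

/-! ### Decay rates for the derivative. -/

section Rates

variable {X : Type*} [NormedAddCommGroup X] [NormedSpace ℝ X] {T : X → X} {f : ℝ → X} {x₀ : X}
  {u : ℝ → X} {ε : ℝ → ℝ} {κ : ℝ}

theorem norm_deriv_le_split (hT : LipschitzWith 1 T) (hu : IsEvolutionSolution T f x₀ u)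
    (hε : IsErrorBound f ε) (hκ : ∀ t, 0 ≤ t → ‖T (u t) - x₀‖ ≤ κ) {t : ℝ} (ht : 0 < t) :
    ‖deriv u t‖ ≤ ε t + (κ + 2 * √2 * ∫ q in (0 : ℝ)..t / 2, ε q) / √(Real.pi * t) +
      2 * ∫ q in t / 2..t, decayProfile (t - q) * ε q := by
  have he := hε.continuous_comp_max
  have he0 : ∀ q, 0 ≤ ε (max 0 q) := fun q => hε.nonneg (le_max_left 0 q)
  have h := norm_deriv_le hT hu he he0
    (fun t ht => by simpa [max_eq_right ht] using hε.norm_le t ht) hκ ht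
  have h2 := integral_decayProfile_mul_le he he0 ht
  have h3 : ∫ q in (0 : ℝ)..t / 2, ε (max 0 q) = ∫ q in (0 : ℝ)..t / 2, ε q :=
    intervalIntegral.integral_congr fun q hq => by
      rw [uIcc_of_le (by linarith)] at hq
      simp only [max_eq_right hq.1]
  have h4 : ∫ q in t / 2..t, decayProfile (t - q) * ε (max 0 q) =
      ∫ q in t / 2..t, decayProfile (t - q) * ε q :=
    intervalIntegral.integral_congr fun q hq => by
      rw [uIcc_of_le (by linarith)] at hq
      simp only [max_eq_right (show (0 : ℝ) ≤ q by linarith [hq.1])]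
  have hκ0 : 0 ≤ κ := (norm_nonneg _).trans (hκ 0 le_rfl)
  have h5 := mul_le_mul_of_nonneg_left (decayProfile_le ht) hκ0
  rw [h3, h4] at h2
  simp only [max_eq_right ht.le] at h
  have h6 : (κ + 2 * √2 * ∫ q in (0 : ℝ)..t / 2, ε q) / √(Real.pi * t) =
    κ * (1 / √(Real.pi * t)) + 2 * (√2 / √(Real.pi * t) * ∫ q in (0 : ℝ)..t / 2, ε q) := by ring
  rw [h6]
  linarith

/-- For each fixed point `p`, the triangle inequality through `p` gives `2‖x₀ - p‖ + S`; the infimum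
over `p` gives `κ`. -/
theorem HypFixedPoint.norm_sub_initial_le (h : HypFixedPoint T ε) (hT : LipschitzWith 1 T)
    (hu : IsEvolutionSolution T f x₀ u) (hε : IsErrorBound f ε) {t : ℝ} (ht : 0 ≤ t) :
    ‖T (u t) - x₀‖ ≤ kappaConst T x₀ ε := by
  have key : (‖T (u t) - x₀‖ - totalError ε) / 2 ≤
      Metric.infDist x₀ (Function.fixedPoints T) := by
    refine (Metric.le_infDist h.nonempty_fix).2 fun p hp => ?_
    have hp' : T p = p := hp
    have h1 := norm_sub_fixedPoint_le hT hu hε.continuous_comp_max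
      (fun t ht => by simpa [max_eq_right ht] using hε.norm_le t ht) hp' ht
    have h3 : ∫ q in (0 : ℝ)..t, ε (max 0 q) = ∫ q in (0 : ℝ)..t, ε q :=
      intervalIntegral.integral_congr fun q hq => by
        rw [uIcc_of_le ht] at hq
        simp only [max_eq_right hq.1]
    have h4 : ‖T (u t) - p‖ ≤ ‖u t - p‖ := by
      have := hT.dist_le_mul (u t) p
      rwa [NNReal.coe_one, one_mul, dist_eq_norm, dist_eq_norm, hp'] at this
    have h5 := norm_sub_le_norm_sub_add_norm_sub (T (u t)) p x₀
    rw [norm_sub_rev p] at h5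
    rw [dist_eq_norm]
    linarith [h.integral_le_totalError hε ht]
  unfold kappaConst
  linarith

theorem HypFixedPoint.norm_deriv_le (h : HypFixedPoint T ε) (hT : LipschitzWith 1 T)
    (hu : IsEvolutionSolution T f x₀ u) (hε : IsErrorBound f ε) {t : ℝ} (ht : 1 ≤ t) :
    ‖deriv u t‖ ≤ nuConst T x₀ ε / √t + ∫ s in Ioi (t / 2), 4 * ε s := by
  have ht0 : 0 < t := by linarith
  have h1 := norm_deriv_le_split hT hu hε (fun s hs => h.norm_sub_initial_le hT hu hε hs) ht0
  have hsub : Icc (t / 2) t ⊆ Ici 0 := fun q hq => le_trans (by linarith) hq.1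
  have hI : IntervalIntegrable ε volume (t / 2) t :=
    (hε.continuousOn.mono hsub).intervalIntegrable_of_Icc (by linarith)
  have h2 : ∫ q in t / 2..t, decayProfile (t - q) * ε q ≤ ∫ q in t / 2..t, ε q := by
    refine intervalIntegral.integral_mono_on (by linarith) ?_ hI fun q hq =>
      mul_le_of_le_one_left (hε.nonneg (hsub hq)) (decayProfile_le_one (by linarith [hq.2]))
    exact hI.continuousOn_mul (continuous_decayProfile.comp (by fun_prop)).continuousOn
  -- Monotonicity of `ε` and `t ≥ 1` give `ε t ≤ 2 ∫ ε` over `[t/2, t]`. Added to the `2 ∫ ε` from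
  -- the recent half of the convolution, this makes the constant `4`.
  have h3 : t / 2 * ε t ≤ ∫ q in t / 2..t, ε q := by
    have := intervalIntegral.integral_mono_on (show t / 2 ≤ t by linarith)
      (intervalIntegrable_const (c := ε t)) hI fun q hq => h.antitoneOn (hsub hq) ht0.le hq.2
    rw [intervalIntegral.integral_const, smul_eq_mul] at this
    linarith
  have h4 : ∫ q in t / 2..t, ε q ≤ ∫ q in Ioi (t / 2), ε q := by
    rw [intervalIntegral.integral_of_le (by linarith)]
    exact setIntegral_mono_set (h.integrableOn.mono_set (Ioi_subset_Ioi (by linarith)))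
      ((ae_restrict_iff' measurableSet_Ioi).2 (Eventually.of_forall fun q hq =>
        hε.nonneg (le_trans (by linarith) (le_of_lt hq))))
      Ioc_subset_Ioi_self.eventuallyLE
  have h5 : (kappaConst T x₀ ε + 2 * √2 * ∫ q in (0 : ℝ)..t / 2, ε q) / √(Real.pi * t) ≤
      nuConst T x₀ ε / √t := by
    rw [nuConst, div_div, ← Real.sqrt_mul Real.pi_pos.le]
    have := h.integral_le_totalError hε (show 0 ≤ t / 2 by linarith)
    gcongr
  rw [integral_const_mul]
  nlinarith [hε.nonneg ht0.le]

theorem HypFixedPoint.norm_deriv_le_weighted (h : HypFixedPoint T ε) (hT : LipschitzWith 1 T)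
    (hu : IsEvolutionSolution T f x₀ u) (hε : IsErrorBound f ε) {φ : ℝ → ℝ}
    (hφ0 : ∀ s, 0 ≤ s → 0 ≤ φ s) (hφ : MonotoneOn φ (Ici 0))
    (hint : IntegrableOn (fun s => φ s * ε s) (Ioi 0)) {t : ℝ} (ht : 1 ≤ t)
    (hpos : 0 < φ (t / 2)) : ‖deriv u t‖ ≤
      nuConst T x₀ ε / √t + 4 * (∫ s in Ioi (0 : ℝ), φ s * ε s) / φ (t / 2) := by
  have hsub : Ioi (t / 2) ⊆ Ioi 0 := Ioi_subset_Ioi (by linarith)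
  refine (h.norm_deriv_le hT hu hε ht).trans (add_le_add_right ?_ _)
  rw [integral_const_mul, mul_div_assoc]
  refine mul_le_mul_of_nonneg_left ?_ (by norm_num)
  rw [le_div_iff₀ hpos, ← integral_mul_const]
  calc ∫ s in Ioi (t / 2), ε s * φ (t / 2) ≤ ∫ s in Ioi (t / 2), φ s * ε s := by
        refine setIntegral_mono_on ((h.integrableOn.mono_set hsub).mul_const _)
          (hint.mono_set hsub) measurableSet_Ioi fun s hs => ?_
        have hs0 : (0 : ℝ) ≤ s := le_of_lt (hsub hs)
        rw [mul_comm]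
        exact mul_le_mul_of_nonneg_right
          (hφ (show (0 : ℝ) ≤ t / 2 by linarith) hs0 (le_of_lt hs)) (hε.nonneg hs0)
    _ ≤ ∫ s in Ioi 0, φ s * ε s :=
        setIntegral_mono_set hint
          ((ae_restrict_iff' measurableSet_Ioi).2 (Eventually.of_forall fun s hs =>
            mul_nonneg (hφ0 s (le_of_lt hs)) (hε.nonneg (le_of_lt hs)))) hsub.eventuallyLE

theorem HypFixedPoint.isBigO_deriv (h : HypFixedPoint T ε) (hT : LipschitzWith 1 T)
    (hu : IsEvolutionSolution T f x₀ u) (hε : IsErrorBound f ε) {a : ℝ} (ha : 0 ≤ a)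
    (hint : IntegrableOn (fun s => s ^ a * ε s) (Ioi 0)) :
    (fun t => deriv u t) =O[atTop] fun t : ℝ => 1 / t ^ min (1 / 2) a := by
  set μ := ∫ s in Ioi (0 : ℝ), s ^ a * ε s
  have hμ : 0 ≤ μ := setIntegral_nonneg measurableSet_Ioi fun s hs =>
    mul_nonneg (Real.rpow_nonneg (le_of_lt hs) a) (hε.nonneg (le_of_lt hs))
  refine IsBigO.of_bound (nuConst T x₀ ε + 4 * μ * 2 ^ a) ?_
  filter_upwards [eventually_ge_atTop 1] with t ht
  have ht0 : 0 < t := by linarith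
  have h1 := h.norm_deriv_le_weighted hT hu hε (φ := fun s => s ^ a)
    (fun s hs => Real.rpow_nonneg hs a)
    (fun s hs r _ hsr => Real.rpow_le_rpow hs hsr ha) hint ht (by positivity)
  have h2 : nuConst T x₀ ε / √t ≤ nuConst T x₀ ε * (1 / t ^ min (1 / 2) a) := by
    rw [div_eq_mul_one_div, Real.sqrt_eq_rpow]
    refine mul_le_mul_of_nonneg_left (one_div_le_one_div_of_le (by positivity) ?_)
      (nuConst_nonneg T x₀ hε)
    exact Real.rpow_le_rpow_of_exponent_le ht (min_le_left _ _)
  have h3 : 4 * μ / (t / 2) ^ a ≤ 4 * μ * 2 ^ a * (1 / t ^ min (1 / 2) a) := by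
    rw [Real.div_rpow ht0.le (by norm_num), div_div_eq_mul_div, div_eq_mul_one_div]
    refine mul_le_mul_of_nonneg_left (one_div_le_one_div_of_le (by positivity) ?_)
      (by positivity)
    exact Real.rpow_le_rpow_of_exponent_le ht (min_le_right _ _)
  rw [Real.norm_of_nonneg (by positivity : 0 ≤ 1 / t ^ min (1 / 2) a), add_mul]
  exact h1.trans (add_le_add h2 h3)

/-- The gauge `g` treats the three regimes uniformly: it must dominate constants (for `κ`), the
power `t ^ (1 - a)` (for `ε t` and the recent half) and the accumulated error (for the old half). It
is later taken to be `t ^ (1 - a)`, `log t` or `1`. -/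
theorem isBigO_deriv_of_isBigO (hT : LipschitzWith 1 T)
    (hu : IsEvolutionSolution T f x₀ u) (hε : IsErrorBound f ε)
    (hκ : ∀ t, 0 ≤ t → ‖T (u t) - x₀‖ ≤ κ) {a : ℝ} (ha : 0 ≤ a)
    (hO : ε =O[atTop] (fun t : ℝ => 1 / t ^ a)) {g : ℝ → ℝ}
    (hg1 : (fun _ => (1 : ℝ)) =O[atTop] g)
    (hga : (fun t : ℝ => t ^ (1 - a)) =O[atTop] g)
    (hgE : (fun t => ∫ q in (0 : ℝ)..t / 2, ε q) =O[atTop] g) :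
    (fun t => deriv u t) =O[atTop] fun t => g t / √t := by
  have hpow : ∀ t : ℝ, 0 < t → t ^ (1 - a) / √t = √t * (1 / t ^ a) := by
    intro t ht
    rw [Real.rpow_sub ht, Real.rpow_one]
    have := Real.sqrt_pos.2 ht
    have h2 := Real.sq_sqrt ht.le
    field_simp
    rw [h2]
  have hbase : (fun t : ℝ => √t * (1 / t ^ a)) =O[atTop] fun t => g t / √t := by
    have : (fun t : ℝ => t ^ (1 - a) / √t) =O[atTop] fun t => g t / √t := by
      simpa only [div_eq_mul_inv] using hga.mul (isBigO_refl (fun t : ℝ => (√t)⁻¹) atTop)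
    refine this.congr' ?_ EventuallyEq.rfl
    filter_upwards [eventually_gt_atTop 0] with t ht using hpow t ht
  have hA : ε =O[atTop] fun t => g t / √t := by
    refine (hO.trans (IsBigO.of_bound 1 ?_)).trans hbase
    filter_upwards [eventually_ge_atTop 1] with t ht
    have ht0 : 0 < t := by linarith
    rw [norm_mul, one_mul]
    exact le_mul_of_one_le_left (norm_nonneg _)
      (by rwa [Real.norm_of_nonneg (Real.sqrt_nonneg t), Real.one_le_sqrt])
  have hB : (fun t => (κ + 2 * √2 * ∫ q in (0 : ℝ)..t / 2, ε q) / √(Real.pi * t)) =O[atTop]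
      fun t => g t / √t := by
    have h1 : (fun t => κ + 2 * √2 * ∫ q in (0 : ℝ)..t / 2, ε q) =O[atTop] g :=
      (((isBigO_const_const κ one_ne_zero atTop).trans hg1)).add (hgE.const_mul_left _)
    have h2 : (fun t : ℝ => (√(Real.pi * t))⁻¹) =O[atTop] fun t => (√t)⁻¹ := by
      have : (fun t : ℝ => (√(Real.pi * t))⁻¹) = fun t => (√Real.pi)⁻¹ * (√t)⁻¹ := by
        ext t; rw [Real.sqrt_mul Real.pi_pos.le, mul_inv]
      rw [this]
      exact (isBigO_refl _ _).const_mul_left _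
    simpa only [div_eq_mul_inv] using h1.mul h2
  have hC : (fun t => ∫ q in t / 2..t, decayProfile (t - q) * ε q) =O[atTop]
      fun t => g t / √t := by
    obtain ⟨C, hC0, hC⟩ := hO.exists_pos
    obtain ⟨N, hN⟩ := eventually_atTop.1 hC.bound
    refine (IsBigO.of_bound (C * 2 ^ a * 2) ?_).trans hbase
    filter_upwards [eventually_ge_atTop (2 * N), eventually_gt_atTop 0] with t htN ht
    -- On the recent half `q ≥ t/2`, so `ε` is uniformly of order `t ^ (-a)` at the cost of `2 ^ a`;
    -- the integrated profile then adds a factor `2√t`.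
    have hpt : ∀ q ∈ Icc (t / 2) t, ε q ≤ C * 2 ^ a * (1 / t ^ a) := by
      intro q hq
      have hq0 : 0 < q := by linarith [hq.1]
      have h1 := (le_abs_self _).trans (hN q (by linarith [hq.1]))
      rw [Real.norm_of_nonneg (by positivity)] at h1
      refine h1.trans ?_
      rw [mul_assoc]
      refine mul_le_mul_of_nonneg_left ?_ hC0.le
      have h2 : (t / 2) ^ a ≤ q ^ a := Real.rpow_le_rpow (by linarith) hq.1 ha
      refine (one_div_le_one_div_of_le (by positivity) h2).trans_eq ?_
      rw [Real.div_rpow ht.le (by norm_num), one_div_div, div_eq_mul_one_div]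
    have hsub : Icc (t / 2) t ⊆ Ici 0 := fun q hq => le_trans (by linarith) hq.1
    have hh : Continuous fun q => decayProfile (t - q) :=
      continuous_decayProfile.comp (by fun_prop)
    have hI : IntervalIntegrable (fun q => decayProfile (t - q) * ε q) volume (t / 2) t :=
      ((hε.continuousOn.mono hsub).intervalIntegrable_of_Icc
        (by linarith)).continuousOn_mul hh.continuousOn
    have h0 : 0 ≤ ∫ q in t / 2..t, decayProfile (t - q) * ε q :=
      intervalIntegral.integral_nonneg (by linarith) fun q hq =>
        mul_nonneg (decayProfile_nonneg _) (hε.nonneg (hsub hq))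
    have h1 : ∫ q in t / 2..t, decayProfile (t - q) * ε q ≤
        ∫ q in t / 2..t, decayProfile (t - q) * (C * 2 ^ a * (1 / t ^ a)) :=
      intervalIntegral.integral_mono_on (by linarith) hI
        ((hh.mul continuous_const).intervalIntegrable _ _)
        fun q hq => mul_le_mul_of_nonneg_left (hpt q hq) (decayProfile_nonneg _)
    rw [intervalIntegral.integral_mul_const, intervalIntegral.integral_comp_sub_left
      (fun y => decayProfile y), sub_self] at h1
    have h2 : ∫ y in (0 : ℝ)..t - t / 2, decayProfile y ≤ 2 * √t :=
      (integral_decayProfile_le (by linarith)).trans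
        (mul_le_mul_of_nonneg_left (Real.sqrt_le_sqrt (by linarith)) (by norm_num))
    have h3 := mul_le_mul_of_nonneg_right h2 (by positivity : 0 ≤ C * 2 ^ a * (1 / t ^ a))
    rw [Real.norm_of_nonneg h0, Real.norm_of_nonneg (by positivity)]
    linarith
  have hsum := (hA.add hB).add (hC.const_mul_left 2)
  refine IsBigO.trans (IsBigO.of_bound 1 ?_) hsum
  filter_upwards [eventually_gt_atTop 0] with t ht
  rw [one_mul]
  exact (norm_deriv_le_split hT hu hε hκ ht).trans (le_abs_self _)

end Rates

theorem mainTheorem10 {X : Type*} [NormedAddCommGroup X] [NormedSpace ℝ X]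
    (T : X → X) (hT : LipschitzWith 1 T)
    (f : ℝ → X) (hf : ContinuousOn f (Ici 0))
    (x₀ : X) (u : ℝ → X) (hu : IsEvolutionSolution T f x₀ u)
    (ε : ℝ → ℝ) (hε : IsErrorBound f ε) :
    (HypFixedPoint T ε →
      (∀ t : ℝ, 1 ≤ t →
        ‖deriv u t‖ ≤ nuConst T x₀ ε / √t + ∫ s in Ioi (t / 2), 4 * ε s) ∧
      (∀ φ : ℝ → ℝ, (∀ s : ℝ, 0 ≤ s → 0 ≤ φ s) → MonotoneOn φ (Ici 0) →
        IntegrableOn (fun s => φ s * ε s) (Ioi 0) →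
        ∀ t : ℝ, 1 ≤ t → 0 < φ (t / 2) →
          ‖deriv u t‖ ≤
            nuConst T x₀ ε / √t + 4 * (∫ s in Ioi (0 : ℝ), φ s * ε s) / φ (t / 2)) ∧
      (∀ a : ℝ, 0 ≤ a → IntegrableOn (fun s => s ^ a * ε s) (Ioi 0) →
        (fun t => deriv u t) =O[atTop] fun t : ℝ => 1 / t ^ min (1 / 2) a)) ∧
    (HypBoundedRange T ∨ HypFixedPoint T ε →
      ∀ a : ℝ, 1 / 2 ≤ a → ε =O[atTop] (fun t : ℝ => 1 / t ^ a) →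
        (a < 1 → (fun t => deriv u t) =O[atTop] fun t : ℝ => 1 / t ^ (a - 1 / 2)) ∧
        (a = 1 → (fun t => deriv u t) =O[atTop] fun t : ℝ => Real.log t / √t) ∧
        (1 < a → (fun t => deriv u t) =O[atTop] fun t : ℝ => 1 / √t)) := by
  refine ⟨fun h => ⟨fun t ht => h.norm_deriv_le hT hu hε ht,
    fun φ h0 hm hi t ht hp => h.norm_deriv_le_weighted hT hu hε h0 hm hi ht hp,
    fun a ha hi => h.isBigO_deriv hT hu hε ha hi⟩, fun h a ha hO => ?_⟩
  obtain ⟨κ, hκ⟩ : ∃ κ, ∀ t, 0 ≤ t → ‖T (u t) - x₀‖ ≤ κ := by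
    rcases h with h | h
    · obtain ⟨κ, hκ⟩ := h.exists_norm_sub_le x₀
      exact ⟨κ, fun t _ => hκ (u t)⟩
    · exact ⟨_, fun t ht => h.norm_sub_initial_le hT hu hε ht⟩
  have ha0 : 0 ≤ a := by linarith
  refine ⟨fun h1 => ?_, fun h1 => ?_, fun h1 => ?_⟩
  · refine (isBigO_deriv_of_isBigO hT hu hε hκ ha0 hO (g := fun t : ℝ => t ^ (1 - a)) ?_
      (isBigO_refl _ _) (isBigO_integral_of_lt_one hε h1 hO)).congr' EventuallyEq.rfl ?_
    · refine IsBigO.of_bound 1 ?_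
      filter_upwards [eventually_ge_atTop 1] with t ht
      have := Real.one_le_rpow ht (show 0 ≤ 1 - a by linarith)
      rwa [norm_one, one_mul, Real.norm_of_nonneg (by linarith)]
    · filter_upwards [eventually_gt_atTop 0] with t ht
      rw [Real.sqrt_eq_rpow, ← Real.rpow_sub ht, one_div (t ^ _), ← Real.rpow_neg ht.le]
      congr 1; ring
  · subst h1
    have hlog : (fun _ => (1 : ℝ)) =O[atTop] Real.log :=
      (isLittleO_const_left.2 (Or.inr
        (tendsto_norm_atTop_atTop.comp Real.tendsto_log_atTop))).isBigO
    exact isBigO_deriv_of_isBigO hT hu hε hκ ha0 hO hlog (by simpa using hlog)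
      (isBigO_integral_of_eq_one hε hO)
  · refine isBigO_deriv_of_isBigO hT hu hε hκ ha0 hO (isBigO_refl _ _) ?_
      (isBigO_integral_of_one_lt hε h1 hO)
    refine IsBigO.of_bound 1 ?_
    filter_upwards [eventually_ge_atTop 1] with t ht
    have := Real.rpow_le_one_of_one_le_of_nonpos ht (show 1 - a ≤ 0 by linarith)
    rwa [norm_one, one_mul, Real.norm_of_nonneg (Real.rpow_nonneg (by linarith) _)]
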